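/- Let $p\ge 0$, let $x_1,x_2,\ldots\in\mathbb R^p$ be fixed (non-random) covariate vectors and let $\beta_0\in\mathbb R^p$. For $x,\beta\in\mathbb R^p$ put $q(x,\beta)=\exp(\beta'x)/\{1+\exp(\beta'x)\}$, and write $q_i=q(x_i,\beta_0)$. Suppose that $Y_1,Y_2,\ldots$ are independent random variables with values in $\{0,1\}$ and $\Pr\{Y_i=1\}=q_i$ for every $i$ (the logistic regression model with true parameter $\beta_0$). Let $\hat\beta_n$ be the maximum likelihood estimator based on the first $n$ observations, that is, a random vector in $\mathbb R^p$ which maximises the log-likelihood $$\beta\mapsto\sum_{i\le n}\bigl[Y_i\log q(x_i,\beta)+(1-Y_i)\log\{1-q(x_i,\beta)\}\bigr]$$ over $\mathbb R^p$ whenever a maximiser exists (its value is arbitrary otherwise). Let $$J_n=\sum_{i\le n}q_i(1-q_i)\,x_ix_i'$$ be the information matrix, and assume that $J_n$ is positive definite for all sufficiently large $n$; let $J_n^{1/2}$ be its positive definite square root and $J_n^{-1/2}$ the inverse of that. Assume that the sequence $\lambda_n=\max_{i\le n}|J_n^{-1/2}x_i|$ is bounded, where $|\cdot|$ is the Euclidean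 norm, and that $$N_n(\delta)=\sum_{i\le n}q_i(1-q_i)\,x_i'J_n^{-1}x_i\,I\{|J_n^{-1/2}x_i|\ge\delta\}\to 0\quad\text{as } n\to\infty,\ \text{for each }\delta>0.$$ (The conditions on $\lambda_n$ and $N_n(\delta)$ concern those $n$ for which $J_n$ is invertible.) Then $$J_n^{1/2}(\hat\beta_n-\beta_0)\to_d N_p(0,I_p)\quad\text{as } n\to\infty.$$ -/

import Mathlib

open MeasureTheory ProbabilityTheory Filter Topology

namespace LogisticRegression

variable {p : ℕ}

/-- The success probability `q(x, β) = exp(β'x) / (1 + exp(β'x))`. -/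
noncomputable def successProb (x β : EuclideanSpace ℝ (Fin p)) : ℝ :=
  Real.exp (inner ℝ β x) / (1 + Real.exp (inner ℝ β x))

/-- The logistic regression model with (non-random) covariate vectors `x 0, x 1, …` and true
parameter `β₀`: the outcomes `Y 0, Y 1, …` are independent, each takes the values `0` and `1`
only, and `Y i` equals `1` with probability `q(x i, β₀)`. -/
structure IsModel {Ω : Type*} [MeasurableSpace Ω] (P : Measure Ω)
    (x : ℕ → EuclideanSpace ℝ (Fin p)) (β₀ : EuclideanSpace ℝ (Fin p)) (Y : ℕ → Ω → ℝ) :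
    Prop where
  aemeasurable : ∀ i, AEMeasurable (Y i) P
  zero_or_one : ∀ i, ∀ᵐ ω ∂P, Y i ω = 0 ∨ Y i ω = 1
  prob_one : ∀ i, P.real {ω | Y i ω = 1} = successProb (x i) β₀
  indep : iIndepFun Y P

/-- The log-likelihood of the parameter `β` given the outcomes `y 0, …, y (n - 1)`. -/
noncomputable def logLikelihood (x : ℕ → EuclideanSpace ℝ (Fin p)) (n : ℕ) (y : ℕ → ℝ)
    (β : EuclideanSpace ℝ (Fin p)) : ℝ :=
  ∑ i ∈ Finset.range n,
    (y i * Real.log (successProb (x i) β) + (1 - y i) * Real.log (1 - successProb (x i) β))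

/-- `β` maximises the log-likelihood of the first `n` observations over the parameter space. -/
def IsMLE (x : ℕ → EuclideanSpace ℝ (Fin p)) (n : ℕ) (y : ℕ → ℝ)
    (β : EuclideanSpace ℝ (Fin p)) : Prop :=
  ∀ β', logLikelihood x n y β' ≤ logLikelihood x n y β

/-- `βhat` is a sequence of maximum likelihood estimators: `βhat n` is a random vector which
maximises the log-likelihood of the first `n` observations whenever a maximiser exists.
(With positive probability there may be no maximiser, for separated data; nothing is
required of the value of `βhat n` there.) -/
structure IsMLESequence {Ω : Type*} [MeasurableSpace Ω] (P : Measure Ω)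
    (x : ℕ → EuclideanSpace ℝ (Fin p)) (Y : ℕ → Ω → ℝ)
    (βhat : ℕ → Ω → EuclideanSpace ℝ (Fin p)) : Prop where
  aemeasurable : ∀ n, AEMeasurable (βhat n) P
  isMLE : ∀ n, ∀ᵐ ω ∂P,
    (∃ β, IsMLE x n (fun i => Y i ω) β) → IsMLE x n (fun i => Y i ω) (βhat n ω)

/-- The information matrix `J_n = ∑ q_i (1 - q_i) x_i x_i'` of the first `n` observations. -/
noncomputable def infoMatrix (x : ℕ → EuclideanSpace ℝ (Fin p)) (β₀ : EuclideanSpace ℝ (Fin p))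
    (n : ℕ) : Matrix (Fin p) (Fin p) ℝ :=
  ∑ i ∈ Finset.range n, (successProb (x i) β₀ * (1 - successProb (x i) β₀)) •
    Matrix.vecMulVec (x i).ofLp (x i).ofLp

open scoped MatrixOrder in
/-- `J_n^{1/2}`, the positive semidefinite square root of the information matrix. -/
noncomputable def infoSqrt (x : ℕ → EuclideanSpace ℝ (Fin p)) (β₀ : EuclideanSpace ℝ (Fin p))
    (n : ℕ) : Matrix (Fin p) (Fin p) ℝ :=
  CFC.sqrt (infoMatrix x β₀ n)

/-- The standardised covariate vector `J_n^{-1/2} x_i`. -/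
noncomputable def stdCovariate (x : ℕ → EuclideanSpace ℝ (Fin p))
    (β₀ : EuclideanSpace ℝ (Fin p)) (n i : ℕ) : EuclideanSpace ℝ (Fin p) :=
  Matrix.toEuclideanCLM (𝕜 := ℝ) (infoSqrt x β₀ n)⁻¹ (x i)

/-- `λ_n`, the largest of the Euclidean norms `|J_n^{-1/2} x_i|` over the first `n` indices. -/
noncomputable def maxNorm (x : ℕ → EuclideanSpace ℝ (Fin p)) (β₀ : EuclideanSpace ℝ (Fin p))
    (n : ℕ) : ℝ :=
  ⨆ i : Fin n, ‖stdCovariate x β₀ n i‖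

/-- `N_n(δ) = ∑ q_i (1 - q_i) x_i' J_n⁻¹ x_i I{|J_n^{-1/2} x_i| ≥ δ}`. -/
noncomputable def lindebergSum (x : ℕ → EuclideanSpace ℝ (Fin p))
    (β₀ : EuclideanSpace ℝ (Fin p)) (n : ℕ) (δ : ℝ) : ℝ :=
  ∑ i ∈ Finset.range n, successProb (x i) β₀ * (1 - successProb (x i) β₀) *
    inner ℝ (x i) (Matrix.toEuclideanCLM (𝕜 := ℝ) (infoMatrix x β₀ n)⁻¹ (x i)) *
    (if δ ≤ ‖stdCovariate x β₀ n i‖ then 1 else 0)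

end LogisticRegression

/-! In the coordinate t = J_n^{1/2}(β - β₀) the log-likelihood is concave and, up to a constant,
equals ⟨t, U_n⟩ - |t|²/2 plus a remainder, where U_n is `stdScore`. The quadratic peaks at U_n. If
the remainder is small on a bounded set, the function is lower on a small sphere about U_n than at
its centre, and concavity extends this to everything outside. So maximisers exist and all lie near
U_n (`exists_isMLE_and_norm_sub_lt`); no prior consistency argument is needed.

A single quantity, `cubicSum`, controls both the remainder (`abs_logLikelihood_sub_le`) and the
distance of the characteristic function of U_n from the Gaussian one
(`IsModel.norm_charFun_stdScore_sub_le`), because the underlying scalar Taylor bounds all carry the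
factor q(1 - q). The Lindeberg condition and the bound on λ_n make it vanish (`cubicSum_le`).
Convergence of characteristic functions also makes U_n tight, hence bounded with high probability,
and Slutsky's theorem transfers the normal limit to the estimator. -/

namespace LogisticRegression

variable {p : ℕ}

/-! ### Taylor bounds for the logistic function and its primitive -/

/-- The cumulant function `u ↦ log (1 + exp u)` of the logistic model. -/
noncomputable def softplus (u : ℝ) : ℝ := Real.log (1 + Real.exp u)

lemma successProb_eq_sigmoid (x β : EuclideanSpace ℝ (Fin p)) :
    successProb x β = Real.sigmoid (inner ℝ β x) := by
  rw [successProb, Real.sigmoid_def, Real.exp_neg]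
  field_simp
  ring

lemma logLikelihood_eq (x : ℕ → EuclideanSpace ℝ (Fin p)) (n : ℕ) (y : ℕ → ℝ)
    (β : EuclideanSpace ℝ (Fin p)) :
    logLikelihood x n y β =
      ∑ i ∈ Finset.range n, (y i * inner ℝ β (x i) - softplus (inner ℝ β (x i))) := by
  refine Finset.sum_congr rfl fun i _ => ?_
  have h : 0 < 1 + Real.exp (inner ℝ β (x i)) := by positivity
  have h1 : 1 - successProb (x i) β = (1 + Real.exp (inner ℝ β (x i)))⁻¹ := by
    rw [successProb]; field_simp; ring
  rw [h1, Real.log_inv, successProb, Real.log_div (Real.exp_pos _).ne' h.ne', Real.log_exp,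
    softplus]
  ring

lemma hasDerivAt_softplus (u : ℝ) : HasDerivAt softplus (Real.sigmoid u) u := by
  have h : 1 + Real.exp u ≠ 0 := by positivity
  convert! ((Real.hasDerivAt_exp u).const_add 1).log h using 1
  rw [Real.sigmoid_def, Real.exp_neg]
  field_simp
  ring

lemma continuous_softplus : Continuous softplus :=
  continuous_iff_continuousAt.2 fun u => (hasDerivAt_softplus u).continuousAt

lemma convexOn_softplus : ConvexOn ℝ Set.univ softplus := by
  refine MonotoneOn.convexOn_of_deriv convex_univ continuous_softplus.continuousOn
    (fun u _ => (hasDerivAt_softplus u).differentiableAt.differentiableWithinAt) ?_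
  rw [funext fun u => (hasDerivAt_softplus u).deriv]
  exact Real.sigmoid_monotone.monotoneOn _

lemma abs_exp_sub_one_le (h : ℝ) : |Real.exp h - 1| ≤ |h| * Real.exp |h| := by
  have := Complex.norm_exp_sub_sum_le_norm_mul_exp (h : ℂ) 1
  simp only [Finset.sum_range_one, pow_zero, Nat.factorial_zero, Nat.cast_one, div_one, pow_one,
    Complex.norm_real, Real.norm_eq_abs] at this
  rwa [← Complex.ofReal_exp, ← Complex.ofReal_one, ← Complex.ofReal_sub, Complex.norm_real,
    Real.norm_eq_abs] at this

lemma abs_exp_sub_one_sub_le (h : ℝ) : |Real.exp h - 1 - h| ≤ h ^ 2 * Real.exp |h| := by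
  have := Complex.norm_exp_sub_sum_le_norm_mul_exp (h : ℂ) 2
  simp only [Finset.sum_range_succ, Finset.sum_range_zero, pow_zero, Nat.factorial_zero,
    Nat.cast_one, div_one, pow_one, Nat.factorial_one, zero_add, Complex.norm_real,
    Real.norm_eq_abs, sq_abs] at this
  rwa [← Complex.ofReal_exp, ← Complex.ofReal_one, ← Complex.ofReal_add, ← Complex.ofReal_sub,
    Complex.norm_real, Real.norm_eq_abs, ← sub_sub] at this

/-- The error keeps the factor q(1 - q), so that summed over observations it is weighted exactly as
the information matrix is. -/
lemma abs_sigmoid_add_sub_le (u h : ℝ) :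
    |Real.sigmoid (u + h) - Real.sigmoid u - Real.sigmoid u * (1 - Real.sigmoid u) * h| ≤
      2 * (Real.sigmoid u * (1 - Real.sigmoid u)) * h ^ 2 * Real.exp (2 * |h|) := by
  have hq0 := Real.sigmoid_pos u
  have hq1 := Real.sigmoid_lt_one u
  have hσ : Real.sigmoid (u + h) = Real.sigmoid u * Real.exp h /
      (1 - Real.sigmoid u + Real.sigmoid u * Real.exp h) := by
    rw [Real.sigmoid_def, Real.sigmoid_def, Real.exp_neg, Real.exp_neg, Real.exp_add]
    have := Real.exp_pos u
    have := Real.exp_pos h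
    have h3 : (1 + (Real.exp u)⁻¹) ≠ 0 := by positivity
    have h4 : 1 - (1 + (Real.exp u)⁻¹)⁻¹ = (1 + Real.exp u)⁻¹ := by field_simp; ring
    rw [h4]
    field_simp
    ring
  set q := Real.sigmoid u
  have hw : 0 < q * (1 - q) := mul_pos hq0 (by linarith)
  have hE : Real.exp (-|h|) ≤ Real.exp h := Real.exp_le_exp.2 (neg_abs_le h)
  have hE1 : Real.exp (-|h|) ≤ 1 := Real.exp_le_one_iff.2 (by simp)
  -- The denominator is a convex combination of 1 and exp h, both at least exp (-|h|).
  have hD : Real.exp (-|h|) ≤ 1 - q + q * Real.exp h := by nlinarith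
  have hD0 : 0 < 1 - q + q * Real.exp h := (Real.exp_pos _).trans_le hD
  have hDinv : (1 - q + q * Real.exp h)⁻¹ ≤ Real.exp |h| := by
    rw [← inv_inv (Real.exp |h|), ← Real.exp_neg]
    exact inv_anti₀ (Real.exp_pos _) hD
  have hid : q * Real.exp h / (1 - q + q * Real.exp h) - q - q * (1 - q) * h =
      q * (1 - q) * ((Real.exp h - 1 - h) - q * (h * (Real.exp h - 1))) *
        (1 - q + q * Real.exp h)⁻¹ := by
    field_simp
    ring
  have hN : |(Real.exp h - 1 - h) - q * (h * (Real.exp h - 1))| ≤ 2 * (h ^ 2 * Real.exp |h|) := by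
    have h1 := abs_exp_sub_one_sub_le h
    have h2 := abs_exp_sub_one_le h
    have h3 : |q * (h * (Real.exp h - 1))| ≤ h ^ 2 * Real.exp |h| := by
      rw [abs_mul, abs_mul, abs_of_pos hq0]
      calc q * (|h| * |Real.exp h - 1|) ≤ 1 * (|h| * (|h| * Real.exp |h|)) := by gcongr
        _ = |h| ^ 2 * Real.exp |h| := by ring
        _ = _ := by rw [sq_abs]
    rw [abs_le] at h1 h3 ⊢
    constructor <;> linarith
  rw [hσ, hid, abs_mul, abs_mul, abs_of_pos hw, abs_of_pos (inv_pos.2 hD0)]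
  calc _ ≤ q * (1 - q) * (2 * (h ^ 2 * Real.exp |h|)) * Real.exp |h| := by gcongr
    _ = _ := by rw [two_mul |h|, Real.exp_add]; ring

/-- The mean value inequality on the ball of radius |h| integrates the preceding bound. -/
lemma abs_softplus_add_sub_le (u h : ℝ) :
    |softplus (u + h) - softplus u - Real.sigmoid u * h -
        Real.sigmoid u * (1 - Real.sigmoid u) * h ^ 2 / 2| ≤
      2 * (Real.sigmoid u * (1 - Real.sigmoid u)) * |h| ^ 3 * Real.exp (2 * |h|) := by
  have hw : 0 < Real.sigmoid u * (1 - Real.sigmoid u) :=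
    mul_pos (Real.sigmoid_pos u) (by linarith [Real.sigmoid_lt_one u])
  set g : ℝ → ℝ := fun s => softplus (u + s) - softplus u - Real.sigmoid u * s -
        Real.sigmoid u * (1 - Real.sigmoid u) * s ^ 2 / 2
  have hg (s : ℝ) : HasDerivAt g (Real.sigmoid (u + s) - Real.sigmoid u -
      Real.sigmoid u * (1 - Real.sigmoid u) * s) s := by
    have h1 : HasDerivAt (fun s => softplus (u + s)) (Real.sigmoid (u + s)) s :=
      (hasDerivAt_softplus (u + s)).comp_const_add u s
    have h2 := ((h1.sub_const (softplus u)).sub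
      ((hasDerivAt_id s).const_mul (Real.sigmoid u))).sub
      ((((hasDerivAt_id s).pow 2).const_mul (Real.sigmoid u * (1 - Real.sigmoid u))).div_const 2)
    convert! h2 using 1
    simp
    ring
  have := (convex_closedBall (0 : ℝ) |h|).norm_image_sub_le_of_norm_hasDerivWithin_le
    (f := g) (C := 2 * (Real.sigmoid u * (1 - Real.sigmoid u)) * |h| ^ 2 * Real.exp (2 * |h|))
    (fun s _ => (hg s).hasDerivWithinAt) (fun s hs => ?_)
    (x := 0) (y := h) (by simp) (by simp)
  · have h0 : g 0 = 0 := by simp [g]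
    rw [h0, sub_zero, sub_zero, Real.norm_eq_abs, Real.norm_eq_abs] at this
    refine this.trans_eq ?_
    ring
  · have hs' : |s| ≤ |h| := by simpa using hs
    refine (abs_sigmoid_add_sub_le u s).trans ?_
    rw [← sq_abs s]
    gcongr

/-! ### Characteristic functions of centred Bernoulli variables -/

lemma abs_exp_neg_sub_le {v : ℝ} (hv : 0 ≤ v) : |Real.exp (-v) - (1 - v)| ≤ v ^ 2 := by
  rcases le_total v 1 with h | h
  · have := Real.abs_exp_sub_one_sub_id_le (x := -v) (by rwa [abs_neg, abs_of_nonneg hv])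
    rw [neg_sq] at this
    convert this using 2
    ring
  · have h1 : Real.exp (-v) ≤ 1 := Real.exp_le_one_iff.2 (by linarith)
    have h2 := Real.exp_pos (-v)
    rw [abs_le]
    constructor <;> nlinarith

open Complex in
lemma norm_exp_I_sub_le {a s : ℝ} (ha : |a| ≤ 1) :
    ‖exp ((a * s : ℝ) * I) - (1 + a * s * I - a ^ 2 * s ^ 2 / 2)‖ ≤
      |a| ^ 3 * (|s| ^ 3 * Real.exp |s|) := by
  have := Complex.norm_exp_sub_sum_le_norm_mul_exp (((a * s : ℝ) : ℂ) * I) 3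
  have hn : ‖((a * s : ℝ) : ℂ) * I‖ = |a| * |s| := by
    rw [norm_mul, norm_real, norm_I, mul_one, Real.norm_eq_abs, abs_mul]
  have hs : ∑ m ∈ Finset.range 3, (((a * s : ℝ) : ℂ) * I) ^ m / m.factorial =
      1 + a * s * I - a ^ 2 * s ^ 2 / 2 := by
    simp [Finset.sum_range_succ, mul_pow]
    ring
  rw [hn, hs] at this
  refine this.trans ?_
  rw [mul_pow, mul_assoc]
  gcongr
  exact mul_le_of_le_one_left (abs_nonneg _) ha

open Complex in
/-- The characteristic function of a centred Bernoulli variable is close to that of the normal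
law with the same variance. -/
lemma norm_bernoulli_charFun_sub_le {q : ℝ} (hq0 : 0 ≤ q) (hq1 : q ≤ 1) (s : ℝ) :
    ‖(q * exp (((1 - q) * s : ℝ) * I) + (1 - q) * exp ((-q * s : ℝ) * I)) -
        (Real.exp (-(q * (1 - q) * s ^ 2 / 2)) : ℂ)‖ ≤
      2 * (q * (1 - q)) * |s| ^ 3 * Real.exp |s| := by
  have hw : 0 ≤ q * (1 - q) := mul_nonneg hq0 (by linarith)
  have h1 := norm_exp_I_sub_le (a := 1 - q) (s := s) (by rw [abs_le]; constructor <;> linarith)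
  have h2 := norm_exp_I_sub_le (a := -q) (s := s) (by rw [abs_le]; constructor <;> linarith)
  have h3 := abs_exp_neg_sub_le (v := q * (1 - q) * s ^ 2 / 2) (by positivity)
  rw [abs_of_nonneg (by linarith : 0 ≤ 1 - q)] at h1
  rw [abs_neg, abs_of_nonneg hq0] at h2
  set B := |s| ^ 3 * Real.exp |s|
  have hB : 0 ≤ B := by positivity
  have hs4 : |s| ^ 4 ≤ B := by
    rw [pow_succ]
    exact mul_le_mul_of_nonneg_left (by linarith [Real.add_one_le_exp |s|]) (by positivity)
  -- The means of the two quadratic Taylor polynomials add up to 1 - q(1 - q)s²/2, the first-order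
  -- expansion of the Gaussian factor; only three remainders are left.
  have key : (q * exp (((1 - q) * s : ℝ) * I) + (1 - q) * exp ((-q * s : ℝ) * I)) -
        (Real.exp (-(q * (1 - q) * s ^ 2 / 2)) : ℂ) =
      q * (exp (((1 - q) * s : ℝ) * I) -
        (1 + (1 - q : ℝ) * s * I - (1 - q : ℝ) ^ 2 * s ^ 2 / 2)) +
      (1 - q : ℝ) * (exp ((-q * s : ℝ) * I) -
        (1 + (-q : ℝ) * s * I - (-q : ℝ) ^ 2 * s ^ 2 / 2)) -
      (Real.exp (-(q * (1 - q) * s ^ 2 / 2)) - (1 - q * (1 - q) * s ^ 2 / 2) : ℝ) := by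
    push_cast
    ring
  rw [key]
  refine (norm_sub_le _ _).trans ((add_le_add (norm_add_le _ _) le_rfl).trans ?_)
  rw [norm_mul, norm_mul, norm_real, norm_real, norm_real, Real.norm_eq_abs, Real.norm_eq_abs,
    Real.norm_eq_abs, abs_of_nonneg hq0, abs_of_nonneg (by linarith : 0 ≤ 1 - q)]
  have e3 : (q * (1 - q) * s ^ 2 / 2) ^ 2 ≤ q * (1 - q) * B := by
    have hw1 : q * (1 - q) ≤ 1 := by nlinarith
    calc (q * (1 - q) * s ^ 2 / 2) ^ 2 = q * (1 - q) * (q * (1 - q) / 4 * |s| ^ 4) := by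
          rw [show |s| ^ 4 = (|s| ^ 2) ^ 2 by ring, sq_abs]; ring
      _ ≤ q * (1 - q) * (1 * B) := by gcongr; linarith
      _ = _ := by ring
  have e12 : q * ((1 - q) ^ 3 * B) + (1 - q) * (q ^ 3 * B) ≤ q * (1 - q) * B := by
    have : q * ((1 - q) ^ 3 * B) + (1 - q) * (q ^ 3 * B) =
      q * (1 - q) * B * ((1 - q) ^ 2 + q ^ 2) := by ring
    rw [this]
    exact mul_le_of_le_one_right (by positivity) (by nlinarith)
  calc _ ≤ q * ((1 - q) ^ 3 * B) + (1 - q) * (q ^ 3 * B) + (q * (1 - q) * s ^ 2 / 2) ^ 2 := by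
        gcongr
    _ ≤ 2 * (q * (1 - q)) * B := by linarith
    _ = _ := by simp only [B]; ring

/-- Exchange the factors one at a time; all the others have norm at most 1. -/
lemma norm_prod_sub_prod_le {ι : Type*} (s : Finset ι) (a b : ι → ℂ) (ha : ∀ i ∈ s, ‖a i‖ ≤ 1)
    (hb : ∀ i ∈ s, ‖b i‖ ≤ 1) : ‖∏ i ∈ s, a i - ∏ i ∈ s, b i‖ ≤ ∑ i ∈ s, ‖a i - b i‖ := by
  classical
  induction s using Finset.induction_on with
  | empty => simp
  | insert i s hi ih =>
    rw [Finset.prod_insert hi, Finset.prod_insert hi, Finset.sum_insert hi]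
    have h1 : ‖∏ j ∈ s, a j‖ ≤ 1 := by
      rw [norm_prod]
      exact Finset.prod_le_one (fun _ _ => norm_nonneg _)
        fun j hj => ha j (Finset.mem_insert_of_mem hj)
    have h2 := ih (fun j hj => ha j (Finset.mem_insert_of_mem hj))
      (fun j hj => hb j (Finset.mem_insert_of_mem hj))
    have h3 := hb i (Finset.mem_insert_self i s)
    have : a i * ∏ j ∈ s, a j - b i * ∏ j ∈ s, b j =
      (a i - b i) * ∏ j ∈ s, a j + b i * (∏ j ∈ s, a j - ∏ j ∈ s, b j) := by ring
    rw [this]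
    refine (norm_add_le _ _).trans ?_
    rw [norm_mul, norm_mul]
    gcongr
    · exact mul_le_of_le_one_right (norm_nonneg _) h1
    · exact (mul_le_of_le_one_left (norm_nonneg _) h3).trans h2

/-! ### Locating maximisers of concave functions -/

section Concave

variable {E : Type*} [NormedAddCommGroup E] [NormedSpace ℝ E]

/-- A concave function that is smaller on a sphere than at its centre is smaller there outside
the ball, too. -/
lemma _root_.ConcaveOn.lt_of_forall_sphere_lt {G : E → ℝ} (hG : ConcaveOn ℝ Set.univ G) {u : E}
    {r : ℝ} (hr : 0 < r) (h : ∀ t, ‖t - u‖ = r → G t < G u) {t : E} (ht : r ≤ ‖t - u‖) :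
    G t < G u := by
  by_contra! hle
  have hpos : 0 < ‖t - u‖ := hr.trans_le ht
  -- With this weight, (1 - a)u + at is where the segment from u to t meets the sphere; concavity
  -- makes G at least G u there if G t ≥ G u.
  set a := r / ‖t - u‖
  have ha0 : 0 ≤ a := by positivity
  have ha1 : a ≤ 1 := div_le_one_of_le₀ ht hpos.le
  have h1 := hG.2 (Set.mem_univ u) (Set.mem_univ t) (sub_nonneg.2 ha1) ha0 (by ring)
  have h2 := h ((1 - a) • u + a • t) (by
    rw [show (1 - a) • u + a • t - u = a • (t - u) by module, norm_smul, Real.norm_eq_abs,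
      abs_of_nonneg ha0]
    exact div_mul_cancel₀ _ hpos.ne')
  simp only [smul_eq_mul] at h1
  nlinarith

lemma _root_.ConcaveOn.exists_forall_le_of_forall_sphere_lt [ProperSpace E] {G : E → ℝ}
    (hG : ConcaveOn ℝ Set.univ G) (hc : Continuous G) {u : E}
    {r : ℝ} (hr : 0 < r) (h : ∀ t, ‖t - u‖ = r → G t < G u) : ∃ t, ∀ s, G s ≤ G t := by
  obtain ⟨t, -, ht⟩ := (isCompact_closedBall u r).exists_isMaxOn
    ⟨u, Metric.mem_closedBall_self hr.le⟩ hc.continuousOn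
  refine ⟨t, fun s => ?_⟩
  rcases le_total ‖s - u‖ r with hs | hs
  · exact ht (by rwa [Metric.mem_closedBall, dist_eq_norm])
  · exact (hG.lt_of_forall_sphere_lt hr h hs).le.trans (ht (Metric.mem_closedBall_self hr.le))

end Concave

/-! ### Standardised covariates -/

/-- The variance `q_i (1 - q_i)` of the `i`-th outcome. -/
noncomputable def outcomeVar (x : ℕ → EuclideanSpace ℝ (Fin p)) (β₀ : EuclideanSpace ℝ (Fin p))
    (i : ℕ) : ℝ :=
  successProb (x i) β₀ * (1 - successProb (x i) β₀)

section

variable (x : ℕ → EuclideanSpace ℝ (Fin p)) (β₀ : EuclideanSpace ℝ (Fin p))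

lemma successProb_nonneg (i : ℕ) : 0 ≤ successProb (x i) β₀ := by
  rw [successProb_eq_sigmoid]; exact Real.sigmoid_nonneg _

lemma successProb_le_one (i : ℕ) : successProb (x i) β₀ ≤ 1 := by
  rw [successProb_eq_sigmoid]; exact Real.sigmoid_le_one _

lemma outcomeVar_nonneg (i : ℕ) : 0 ≤ outcomeVar x β₀ i :=
  mul_nonneg (successProb_nonneg x β₀ i) (sub_nonneg.2 (successProb_le_one x β₀ i))

lemma inner_toEuclideanCLM_comm {A : Matrix (Fin p) (Fin p) ℝ} (hA : A.IsHermitian)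
    (a b : EuclideanSpace ℝ (Fin p)) :
    inner ℝ (Matrix.toEuclideanCLM (𝕜 := ℝ) A a) b =
      inner ℝ a (Matrix.toEuclideanCLM (𝕜 := ℝ) A b) := by
  rw [← ContinuousLinearMap.adjoint_inner_right, ← ContinuousLinearMap.star_eq_adjoint, ← map_star,
    Matrix.star_eq_conjTranspose, hA.eq]

lemma toEuclideanCLM_mul_apply (A B : Matrix (Fin p) (Fin p) ℝ) (a : EuclideanSpace ℝ (Fin p)) :
    Matrix.toEuclideanCLM (𝕜 := ℝ) A (Matrix.toEuclideanCLM (𝕜 := ℝ) B a) =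
      Matrix.toEuclideanCLM (𝕜 := ℝ) (A * B) a := by
  rw [map_mul]; rfl

variable {x β₀} {n : ℕ}

open scoped MatrixOrder in
lemma isHermitian_infoSqrt : (infoSqrt x β₀ n).IsHermitian :=
  (Matrix.nonneg_iff_posSemidef.1 (CFC.sqrt_nonneg (infoMatrix x β₀ n))).isHermitian

open scoped MatrixOrder in
lemma infoSqrt_mul_self (hJ : (infoMatrix x β₀ n).PosDef) :
    infoSqrt x β₀ n * infoSqrt x β₀ n = infoMatrix x β₀ n :=
  CFC.sqrt_mul_sqrt_self _ hJ.posSemidef.nonneg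

lemma isUnit_det_infoSqrt (hJ : (infoMatrix x β₀ n).PosDef) : IsUnit (infoSqrt x β₀ n).det := by
  have h := hJ.det_pos
  rw [← infoSqrt_mul_self hJ, Matrix.det_mul] at h
  exact isUnit_iff_ne_zero.2 fun h0 => by simp [h0] at h

lemma infoSqrt_apply_inv_apply (hJ : (infoMatrix x β₀ n).PosDef) (t : EuclideanSpace ℝ (Fin p)) :
    Matrix.toEuclideanCLM (𝕜 := ℝ) (infoSqrt x β₀ n)
      (Matrix.toEuclideanCLM (𝕜 := ℝ) (infoSqrt x β₀ n)⁻¹ t) = t := by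
  rw [toEuclideanCLM_mul_apply, Matrix.mul_nonsing_inv _ (isUnit_det_infoSqrt hJ), map_one]
  rfl

lemma inv_infoSqrt_apply_apply (hJ : (infoMatrix x β₀ n).PosDef) (t : EuclideanSpace ℝ (Fin p)) :
    Matrix.toEuclideanCLM (𝕜 := ℝ) (infoSqrt x β₀ n)⁻¹
      (Matrix.toEuclideanCLM (𝕜 := ℝ) (infoSqrt x β₀ n) t) = t := by
  rw [toEuclideanCLM_mul_apply, Matrix.nonsing_inv_mul _ (isUnit_det_infoSqrt hJ), map_one]
  rfl

lemma inner_inv_infoSqrt_apply (i : ℕ) (t : EuclideanSpace ℝ (Fin p)) :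
    inner ℝ (Matrix.toEuclideanCLM (𝕜 := ℝ) (infoSqrt x β₀ n)⁻¹ t) (x i) =
      inner ℝ t (stdCovariate x β₀ n i) :=
  inner_toEuclideanCLM_comm isHermitian_infoSqrt.inv _ _

lemma inner_inv_infoMatrix (hJ : (infoMatrix x β₀ n).PosDef) (i : ℕ) :
    inner ℝ (x i) (Matrix.toEuclideanCLM (𝕜 := ℝ) (infoMatrix x β₀ n)⁻¹ (x i)) =
      ‖stdCovariate x β₀ n i‖ ^ 2 := by
  rw [← infoSqrt_mul_self hJ, Matrix.mul_inv_rev, ← toEuclideanCLM_mul_apply,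
    ← inner_toEuclideanCLM_comm isHermitian_infoSqrt.inv, ← real_inner_self_eq_norm_sq]
  rfl

lemma inner_infoMatrix_apply (v : EuclideanSpace ℝ (Fin p)) :
    inner ℝ v (Matrix.toEuclideanCLM (𝕜 := ℝ) (infoMatrix x β₀ n) v) =
      ∑ i ∈ Finset.range n, outcomeVar x β₀ i * inner ℝ v (x i) ^ 2 := by
  have h (a : EuclideanSpace ℝ (Fin p)) :
      inner ℝ v (Matrix.toEuclideanCLM (𝕜 := ℝ) (Matrix.vecMulVec a.ofLp a.ofLp) v) =
        inner ℝ v a ^ 2 := by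
    have h1 : inner ℝ v a = v.ofLp ⬝ᵥ a.ofLp := by
      rw [EuclideanSpace.inner_eq_star_dotProduct, star_trivial, dotProduct_comm]
    rw [Matrix.inner_toEuclideanCLM, Matrix.vecMulVec_mulVec, h1, sq]
    simp [dotProduct_smul, dotProduct_comm a.ofLp v.ofLp]
  simp_rw [infoMatrix, map_sum, sum_apply, inner_sum, map_smul,
    smul_apply, inner_smul_right, h]
  rfl

/-- The standardised covariate vectors have weighted second moment matrix `I_p`. -/
lemma sum_outcomeVar_mul_inner_sq (hJ : (infoMatrix x β₀ n).PosDef)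
    (t : EuclideanSpace ℝ (Fin p)) :
    ∑ i ∈ Finset.range n, outcomeVar x β₀ i * inner ℝ t (stdCovariate x β₀ n i) ^ 2 =
      ‖t‖ ^ 2 := by
  simp_rw [← inner_inv_infoSqrt_apply]
  rw [← inner_infoMatrix_apply, ← infoSqrt_mul_self hJ, ← toEuclideanCLM_mul_apply,
    ← inner_toEuclideanCLM_comm isHermitian_infoSqrt, infoSqrt_apply_inv_apply hJ,
    real_inner_self_eq_norm_sq]

/-- This is the trace of the identity matrix: sum the preceding identity over an orthonormal basis.
-/
lemma sum_outcomeVar_mul_norm_sq (hJ : (infoMatrix x β₀ n).PosDef) :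
    ∑ i ∈ Finset.range n, outcomeVar x β₀ i * ‖stdCovariate x β₀ n i‖ ^ 2 = p := by
  have h (z : EuclideanSpace ℝ (Fin p)) :
      ‖z‖ ^ 2 = ∑ j, inner ℝ (EuclideanSpace.basisFun (Fin p) ℝ j) z ^ 2 := by
    simp [EuclideanSpace.norm_sq_eq, EuclideanSpace.inner_single_left]
  simp_rw [h, Finset.mul_sum]
  rw [Finset.sum_comm]
  simp_rw [sum_outcomeVar_mul_inner_sq hJ]
  simp

lemma norm_stdCovariate_le_maxNorm {i : ℕ} (hi : i < n) :
    ‖stdCovariate x β₀ n i‖ ≤ maxNorm x β₀ n :=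
  le_ciSup (f := fun i : Fin n => ‖stdCovariate x β₀ n i‖) (Set.finite_range _).bddAbove ⟨i, hi⟩

end

/-! ### The third-order sum and the Lindeberg condition -/

/-- The weighted sum `∑ q_i (1 - q_i) |J_n^{-1/2} x_i| ^ 3`. -/
noncomputable def cubicSum (x : ℕ → EuclideanSpace ℝ (Fin p)) (β₀ : EuclideanSpace ℝ (Fin p))
    (n : ℕ) : ℝ :=
  ∑ i ∈ Finset.range n, outcomeVar x β₀ i * ‖stdCovariate x β₀ n i‖ ^ 3

lemma cubicSum_nonneg (x : ℕ → EuclideanSpace ℝ (Fin p)) (β₀ : EuclideanSpace ℝ (Fin p))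
    (n : ℕ) : 0 ≤ cubicSum x β₀ n :=
  Finset.sum_nonneg fun i _ => mul_nonneg (outcomeVar_nonneg x β₀ i) (by positivity)

/-- Split at δ: one factor of the cube is below δ for short vectors and at most L for long ones. -/
lemma cubicSum_le {x : ℕ → EuclideanSpace ℝ (Fin p)} {β₀ : EuclideanSpace ℝ (Fin p)} {n : ℕ}
    (hJ : (infoMatrix x β₀ n).PosDef) {L : ℝ} (hL : ∀ i < n, ‖stdCovariate x β₀ n i‖ ≤ L)
    {δ : ℝ} (hδ : 0 ≤ δ) :
    cubicSum x β₀ n ≤ δ * p + L * lindebergSum x β₀ n δ := by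
  rw [← sum_outcomeVar_mul_norm_sq hJ, lindebergSum, Finset.mul_sum, Finset.mul_sum,
    ← Finset.sum_add_distrib]
  refine Finset.sum_le_sum fun i hi => ?_
  rw [inner_inv_infoMatrix hJ, ← outcomeVar]
  have hw := outcomeVar_nonneg x β₀ i
  have hz := hL i (Finset.mem_range.1 hi)
  set z := ‖stdCovariate x β₀ n i‖
  have hz0 : 0 ≤ z := norm_nonneg _
  have hwz : 0 ≤ outcomeVar x β₀ i * z ^ 2 := by positivity
  split_ifs with h
  · nlinarith [mul_nonneg hwz hδ]
  · nlinarith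

lemma tendsto_cubicSum {x : ℕ → EuclideanSpace ℝ (Fin p)} {β₀ : EuclideanSpace ℝ (Fin p)}
    (hJ : ∀ᶠ n in atTop, (infoMatrix x β₀ n).PosDef) {L : ℝ}
    (hL : ∀ n, ∀ i < n, ‖stdCovariate x β₀ n i‖ ≤ L)
    (hN : ∀ δ : ℝ, 0 < δ → Tendsto (fun n => lindebergSum x β₀ n δ) atTop (𝓝 0)) :
    Tendsto (cubicSum x β₀) atTop (𝓝 0) := by
  refine tendsto_order.2 ⟨fun a ha => Eventually.of_forall fun n =>
    ha.trans_le (cubicSum_nonneg x β₀ n), fun ε hε => ?_⟩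
  -- Dividing by p + 1 rather than p covers p = 0.
  set δ : ℝ := ε / (2 * (p + 1))
  have hδ : 0 < δ := by positivity
  have hδp : δ * p < ε := by
    have h1 : δ * (p + 1) = ε / 2 := by simp only [δ]; field_simp
    nlinarith
  have h := (hN δ hδ).const_mul L |>.const_add (δ * p)
  rw [mul_zero, add_zero] at h
  filter_upwards [hJ, h.eventually (gt_mem_nhds hδp)] with n hn h1
  exact (cubicSum_le hn (hL n) hδ.le).trans_lt h1

/-- The standardised score `∑ (y_i - q_i) J_n^{-1/2} x_i` at the true parameter. -/
noncomputable def stdScore (x : ℕ → EuclideanSpace ℝ (Fin p)) (β₀ : EuclideanSpace ℝ (Fin p))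
    (n : ℕ) (y : ℕ → ℝ) : EuclideanSpace ℝ (Fin p) :=
  ∑ i ∈ Finset.range n, (y i - successProb (x i) β₀) • stdCovariate x β₀ n i

/-! ### Quadratic approximation of the log-likelihood -/

section Likelihood

variable {x : ℕ → EuclideanSpace ℝ (Fin p)} {β₀ : EuclideanSpace ℝ (Fin p)} {n : ℕ}

lemma abs_inner_stdCovariate_le {L : ℝ} (hL : ∀ i < n, ‖stdCovariate x β₀ n i‖ ≤ L) {i : ℕ}
    (hi : i < n) (t : EuclideanSpace ℝ (Fin p)) :
    |inner ℝ t (stdCovariate x β₀ n i)| ≤ ‖t‖ * L :=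
  (abs_real_inner_le_norm _ _).trans (mul_le_mul_of_nonneg_left (hL i hi) (norm_nonneg _))

lemma sum_outcomeVar_mul_abs_inner_cubed_le (t : EuclideanSpace ℝ (Fin p)) :
    ∑ i ∈ Finset.range n, outcomeVar x β₀ i * |inner ℝ t (stdCovariate x β₀ n i)| ^ 3 ≤
      ‖t‖ ^ 3 * cubicSum x β₀ n := by
  rw [cubicSum, Finset.mul_sum]
  refine Finset.sum_le_sum fun i _ => ?_
  have hw := outcomeVar_nonneg x β₀ i
  calc _ ≤ outcomeVar x β₀ i * (‖t‖ * ‖stdCovariate x β₀ n i‖) ^ 3 := by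
        gcongr; exact abs_real_inner_le_norm _ _
    _ = _ := by ring

/-- Quadratic expansion of the log-likelihood around the true parameter. -/
lemma abs_logLikelihood_sub_le (hJ : (infoMatrix x β₀ n).PosDef) {L : ℝ}
    (hL : ∀ i < n, ‖stdCovariate x β₀ n i‖ ≤ L) (y : ℕ → ℝ) (t : EuclideanSpace ℝ (Fin p)) :
    |logLikelihood x n y (β₀ + Matrix.toEuclideanCLM (𝕜 := ℝ) (infoSqrt x β₀ n)⁻¹ t) -
        logLikelihood x n y β₀ - (inner ℝ t (stdScore x β₀ n y) - ‖t‖ ^ 2 / 2)| ≤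
      2 * ‖t‖ ^ 3 * Real.exp (2 * (‖t‖ * L)) * cubicSum x β₀ n := by
  have key : logLikelihood x n y (β₀ + Matrix.toEuclideanCLM (𝕜 := ℝ) (infoSqrt x β₀ n)⁻¹ t) -
        logLikelihood x n y β₀ - (inner ℝ t (stdScore x β₀ n y) - ‖t‖ ^ 2 / 2) =
      -∑ i ∈ Finset.range n, (softplus (inner ℝ β₀ (x i) + inner ℝ t (stdCovariate x β₀ n i)) -
        softplus (inner ℝ β₀ (x i)) -
        Real.sigmoid (inner ℝ β₀ (x i)) * inner ℝ t (stdCovariate x β₀ n i) -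
        Real.sigmoid (inner ℝ β₀ (x i)) * (1 - Real.sigmoid (inner ℝ β₀ (x i))) *
          inner ℝ t (stdCovariate x β₀ n i) ^ 2 / 2) := by
    rw [← sum_outcomeVar_mul_inner_sq hJ t, logLikelihood_eq, logLikelihood_eq, stdScore,
      inner_sum, Finset.sum_div, ← Finset.sum_sub_distrib, ← Finset.sum_sub_distrib,
      ← Finset.sum_sub_distrib, ← Finset.sum_neg_distrib]
    refine Finset.sum_congr rfl fun i _ => ?_
    rw [inner_add_left, inner_inv_infoSqrt_apply, inner_smul_right, outcomeVar,
      successProb_eq_sigmoid]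
    ring
  rw [key, abs_neg]
  calc _ ≤ ∑ i ∈ Finset.range n, 2 * Real.exp (2 * (‖t‖ * L)) *
          (outcomeVar x β₀ i * |inner ℝ t (stdCovariate x β₀ n i)| ^ 3) := by
        refine (Finset.abs_sum_le_sum_abs _ _).trans (Finset.sum_le_sum fun i hi => ?_)
        refine (abs_softplus_add_sub_le _ _).trans ?_
        have hi' := abs_inner_stdCovariate_le hL (Finset.mem_range.1 hi) t
        have hw := outcomeVar_nonneg x β₀ i
        rw [← successProb_eq_sigmoid, ← outcomeVar]
        calc _ ≤ 2 * outcomeVar x β₀ i * |inner ℝ t (stdCovariate x β₀ n i)| ^ 3 *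
              Real.exp (2 * (‖t‖ * L)) := by gcongr
          _ = _ := by ring
    _ ≤ 2 * Real.exp (2 * (‖t‖ * L)) * (‖t‖ ^ 3 * cubicSum x β₀ n) := by
        rw [← Finset.mul_sum]
        exact mul_le_mul_of_nonneg_left (sum_outcomeVar_mul_abs_inner_cubed_le t) (by positivity)
    _ = _ := by ring

lemma continuous_logLikelihood (y : ℕ → ℝ) : Continuous (logLikelihood x n y) := by
  rw [funext (logLikelihood_eq x n y)]
  have := continuous_softplus
  fun_prop

lemma concaveOn_logLikelihood (y : ℕ → ℝ) : ConcaveOn ℝ Set.univ (logLikelihood x n y) := by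
  rw [funext (logLikelihood_eq x n y)]
  refine ⟨convex_univ, fun β _ γ _ a b ha hb hab => ?_⟩
  simp only [smul_eq_mul, Finset.mul_sum]
  rw [← Finset.sum_add_distrib]
  refine Finset.sum_le_sum fun i _ => ?_
  have h := convexOn_softplus.2 (Set.mem_univ (inner ℝ β (x i))) (Set.mem_univ (inner ℝ γ (x i)))
    ha hb hab
  simp only [smul_eq_mul] at h
  rw [inner_add_left, real_inner_smul_left, real_inner_smul_left]
  linarith

/-- If the cubic remainder is small, then a maximum likelihood estimate exists, and each of them,
standardised, is close to the standardised score. -/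
lemma exists_isMLE_and_norm_sub_lt (hJ : (infoMatrix x β₀ n).PosDef) {L : ℝ} (hL0 : 0 ≤ L)
    (hL : ∀ i < n, ‖stdCovariate x β₀ n i‖ ≤ L) (y : ℕ → ℝ) {K r : ℝ}
    (hK : ‖stdScore x β₀ n y‖ ≤ K) (hr0 : 0 < r) (hr1 : r ≤ 1)
    (hC : 2 * (K + 1) ^ 3 * Real.exp (2 * ((K + 1) * L)) * cubicSum x β₀ n < r ^ 2 / 4) :
    (∃ β, IsMLE x n y β) ∧ ∀ β, IsMLE x n y β →
      ‖Matrix.toEuclideanCLM (𝕜 := ℝ) (infoSqrt x β₀ n) (β - β₀) - stdScore x β₀ n y‖ < r := by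
  set u := stdScore x β₀ n y
  set G : EuclideanSpace ℝ (Fin p) → ℝ := fun t =>
    logLikelihood x n y (β₀ + Matrix.toEuclideanCLM (𝕜 := ℝ) (infoSqrt x β₀ n)⁻¹ t)
  have hGβ (β : EuclideanSpace ℝ (Fin p)) : logLikelihood x n y β =
      G (Matrix.toEuclideanCLM (𝕜 := ℝ) (infoSqrt x β₀ n) (β - β₀)) := by
    simp only [G]
    rw [inv_infoSqrt_apply_apply hJ, add_sub_cancel]
  have hGc : Continuous G := (continuous_logLikelihood y).comp (by fun_prop)
  have hG : ConcaveOn ℝ Set.univ G := by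
    refine ⟨convex_univ, fun s _ t _ a b ha hb hab => ?_⟩
    refine ((concaveOn_logLikelihood y).2 (Set.mem_univ _) (Set.mem_univ _) ha hb hab).trans_eq ?_
    simp only [G, map_add, map_smul]
    congr 1
    calc _ = (a + b) • β₀ + (a • Matrix.toEuclideanCLM (𝕜 := ℝ) (infoSqrt x β₀ n)⁻¹ s +
          b • Matrix.toEuclideanCLM (𝕜 := ℝ) (infoSqrt x β₀ n)⁻¹ t) := by module
      _ = _ := by rw [hab, one_smul]
  have hbound (t : EuclideanSpace ℝ (Fin p)) (ht : ‖t‖ ≤ K + 1) :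
      |G t - logLikelihood x n y β₀ - (inner ℝ t u - ‖t‖ ^ 2 / 2)| < r ^ 2 / 4 := by
    refine ((abs_logLikelihood_sub_le hJ hL y t).trans ?_).trans_lt hC
    have := cubicSum_nonneg x β₀ n
    have hK0 : 0 ≤ K := (norm_nonneg _).trans hK
    gcongr
  -- The quadratic is |u|²/2 - |t - u|²/2, so it drops by r²/2 from u to the sphere, while the
  -- errors at t and u are each below r²/4. Since r ≤ 1, the sphere stays in the ball of radius K +
  -- 1.
  have hsphere (t : EuclideanSpace ℝ (Fin p)) (ht : ‖t - u‖ = r) : G t < G u := by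
    have htK : ‖t‖ ≤ K + 1 := by
      have := norm_le_norm_add_norm_sub u t
      rw [norm_sub_rev] at this
      linarith
    have h1 := (abs_lt.1 (hbound t htK)).2
    have h2 := (abs_lt.1 (hbound u (by linarith))).1
    have h3 := norm_sub_sq_real t u
    rw [ht] at h3
    rw [real_inner_self_eq_norm_sq] at h2
    linarith
  constructor
  · obtain ⟨t, ht⟩ := hG.exists_forall_le_of_forall_sphere_lt hGc hr0 hsphere
    exact ⟨_, fun β => (hGβ β).trans_le (ht _)⟩
  · intro β hβ
    by_contra! hle
    have h1 := hG.lt_of_forall_sphere_lt hr0 hsphere hle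
    rw [← hGβ] at h1
    exact h1.not_ge (hβ _)

end Likelihood

/-! ### Limit law of the score and comparison with the estimator -/

section CentralLimit

variable {Ω : Type*} [MeasurableSpace Ω] {P : Measure Ω}
  {x : ℕ → EuclideanSpace ℝ (Fin p)} {β₀ : EuclideanSpace ℝ (Fin p)} {Y : ℕ → Ω → ℝ}

lemma IsModel.aemeasurable_stdScore (hY : IsModel P x β₀ Y) (n : ℕ) :
    AEMeasurable (fun ω => stdScore x β₀ n (fun i => Y i ω)) P :=
  Finset.aemeasurable_fun_sum _ fun i _ =>
    ((hY.aemeasurable i).sub_const (successProb (x i) β₀)).smul_const _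

variable [IsProbabilityMeasure P]

/-- No measurability of f is needed, since f(Y i) agrees almost everywhere with a two-valued
function. -/
lemma IsModel.integral_eq (hY : IsModel P x β₀ Y) (i : ℕ) (f : ℝ → ℂ) :
    ∫ ω, f (Y i ω) ∂P = successProb (x i) β₀ * f 1 + (1 - successProb (x i) β₀) * f 0 := by
  have hms : NullMeasurableSet {ω | Y i ω = 1} P :=
    (hY.aemeasurable i).nullMeasurableSet_preimage (measurableSet_singleton 1)
  have h1 : (fun ω => f (Y i ω)) =ᵐ[P]
      fun ω => f 0 + {ω | Y i ω = 1}.indicator (fun _ => f 1 - f 0) ω := by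
    filter_upwards [hY.zero_or_one i] with ω hω
    rcases hω with h | h <;> simp [h]
  rw [integral_congr_ae h1, integral_add (integrable_const _)
    ((integrable_const _).indicator₀ hms), integral_indicator₀ hms, setIntegral_const,
    hY.prob_one i]
  simp
  ring

lemma IsModel.charFun_map_smul (hY : IsModel P x β₀ Y) (i : ℕ) (z t : EuclideanSpace ℝ (Fin p)) :
    charFun (P.map fun ω => (Y i ω - successProb (x i) β₀) • z) t =
      successProb (x i) β₀ *
          Complex.exp (((1 - successProb (x i) β₀) * inner ℝ t z : ℝ) * Complex.I) +
        (1 - successProb (x i) β₀) *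
          Complex.exp ((-successProb (x i) β₀ * inner ℝ t z : ℝ) * Complex.I) := by
  have hm : AEMeasurable (fun ω => (Y i ω - successProb (x i) β₀) • z) P :=
    ((hY.aemeasurable i).sub_const _).smul_const _
  rw [charFun_apply, integral_map hm (by fun_prop)]
  simp_rw [real_inner_smul_left, real_inner_comm t z]
  rw [hY.integral_eq i fun y =>
    Complex.exp (((y - successProb (x i) β₀) * inner ℝ t z : ℝ) * Complex.I)]
  simp only [zero_sub]

lemma IsModel.norm_charFun_stdScore_sub_le (hY : IsModel P x β₀ Y) {n : ℕ}
    (hJ : (infoMatrix x β₀ n).PosDef) {L : ℝ} (hL : ∀ i < n, ‖stdCovariate x β₀ n i‖ ≤ L)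
    (t : EuclideanSpace ℝ (Fin p)) :
    ‖charFun (P.map fun ω => stdScore x β₀ n (fun i => Y i ω)) t -
        Complex.exp (-‖t‖ ^ 2 / 2)‖ ≤
      2 * ‖t‖ ^ 3 * Real.exp (‖t‖ * L) * cubicSum x β₀ n := by
  set X : ℕ → Ω → EuclideanSpace ℝ (Fin p) := fun i ω =>
    (Y i ω - successProb (x i) β₀) • stdCovariate x β₀ n i
  have hm (i : ℕ) : AEMeasurable (X i) P := ((hY.aemeasurable i).sub_const _).smul_const _
  have hind : iIndepFun X P := hY.indep.comp
    (fun i y => (y - successProb (x i) β₀) • stdCovariate x β₀ n i) fun i => by fun_prop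
  have hprod : charFun (P.map fun ω => stdScore x β₀ n (fun i => Y i ω)) t =
      ∏ i ∈ Finset.range n, charFun (P.map (X i)) t := by
    have := (hind.restrict (Finset.range n)).charFun_map_fun_finsetSum_eq_prod fun i _ => hm i
    exact (congrFun this t).trans (Finset.prod_apply _ _ _)
  -- The standardised weights sum to |t|², so the Gaussian limit factors over the observations,
  -- ready for comparison factor by factor.
  have hexp : Complex.exp (-‖t‖ ^ 2 / 2) = ∏ i ∈ Finset.range n,
      (Real.exp (-(outcomeVar x β₀ i * inner ℝ t (stdCovariate x β₀ n i) ^ 2 / 2)) : ℂ) := by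
    rw [← Complex.ofReal_prod, ← Real.exp_sum, Finset.sum_neg_distrib, ← Finset.sum_div,
      sum_outcomeVar_mul_inner_sq hJ]
    push_cast
    rw [neg_div]
  rw [hprod, hexp]
  refine (norm_prod_sub_prod_le _ _ _ (fun i _ => ?_) fun i _ => ?_).trans ?_
  · have := Measure.isProbabilityMeasure_map (hm i)
    exact norm_charFun_le_one t
  · rw [Complex.norm_real, Real.norm_eq_abs, Real.abs_exp, Real.exp_le_one_iff, neg_nonpos]
    have := outcomeVar_nonneg x β₀ i
    positivity
  calc _ ≤ ∑ i ∈ Finset.range n, 2 * Real.exp (‖t‖ * L) *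
          (outcomeVar x β₀ i * |inner ℝ t (stdCovariate x β₀ n i)| ^ 3) := by
        refine Finset.sum_le_sum fun i hi => ?_
        rw [hY.charFun_map_smul i]
        refine (norm_bernoulli_charFun_sub_le (successProb_nonneg x β₀ i)
          (successProb_le_one x β₀ i) _).trans ?_
        have hi' := abs_inner_stdCovariate_le hL (Finset.mem_range.1 hi) t
        have hw := outcomeVar_nonneg x β₀ i
        rw [← outcomeVar]
        calc _ ≤ 2 * outcomeVar x β₀ i * |inner ℝ t (stdCovariate x β₀ n i)| ^ 3 *
              Real.exp (‖t‖ * L) := by gcongr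
          _ = _ := by ring
    _ ≤ 2 * Real.exp (‖t‖ * L) * (‖t‖ ^ 3 * cubicSum x β₀ n) := by
        rw [← Finset.mul_sum]
        exact mul_le_mul_of_nonneg_left (sum_outcomeVar_mul_abs_inner_cubed_le t) (by positivity)
    _ = _ := by ring

lemma IsModel.tendsto_charFun_stdScore (hY : IsModel P x β₀ Y)
    (hJ : ∀ᶠ n in atTop, (infoMatrix x β₀ n).PosDef) {L : ℝ}
    (hL : ∀ n, ∀ i < n, ‖stdCovariate x β₀ n i‖ ≤ L)
    (hC : Tendsto (cubicSum x β₀) atTop (𝓝 0)) (t : EuclideanSpace ℝ (Fin p)) :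
    Tendsto (fun n => charFun (P.map fun ω => stdScore x β₀ n (fun i => Y i ω)) t) atTop
      (𝓝 (Complex.exp (-‖t‖ ^ 2 / 2))) := by
  rw [tendsto_iff_norm_sub_tendsto_zero]
  have h := hC.const_mul (2 * ‖t‖ ^ 3 * Real.exp (‖t‖ * L))
  rw [mul_zero] at h
  refine squeeze_zero' (Eventually.of_forall fun n => norm_nonneg _) ?_ h
  filter_upwards [hJ] with n hn
  exact hY.norm_charFun_stdScore_sub_le hn (hL n) t

/-- Asymptotic normality of the standardised score. -/
lemma IsModel.tendstoInDistribution_stdScore (hY : IsModel P x β₀ Y)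
    (hJ : ∀ᶠ n in atTop, (infoMatrix x β₀ n).PosDef) {L : ℝ}
    (hL : ∀ n, ∀ i < n, ‖stdCovariate x β₀ n i‖ ≤ L)
    (hC : Tendsto (cubicSum x β₀) atTop (𝓝 0)) :
    TendstoInDistribution (fun n ω => stdScore x β₀ n (fun i => Y i ω)) atTop
      (id : EuclideanSpace ℝ (Fin p) → EuclideanSpace ℝ (Fin p)) (fun _ => P)
      (multivariateGaussian 0 (1 : Matrix (Fin p) (Fin p) ℝ)) where
  forall_aemeasurable := hY.aemeasurable_stdScore
  aemeasurable_limit := aemeasurable_id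
  tendsto := by
    refine ProbabilityMeasure.tendsto_iff_tendsto_charFun.2 fun t => ?_
    simp only [ProbabilityMeasure.coe_mk, Measure.map_id, multivariateGaussian_zero_one,
      charFun_stdGaussian]
    exact hY.tendsto_charFun_stdScore hJ hL hC t

/-- Pointwise convergence of characteristic functions to a continuous limit gives tightness, hence
one K for all n. -/
lemma IsModel.exists_forall_measure_norm_stdScore_gt_le (hY : IsModel P x β₀ Y)
    (hJ : ∀ᶠ n in atTop, (infoMatrix x β₀ n).PosDef) {L : ℝ}
    (hL : ∀ n, ∀ i < n, ‖stdCovariate x β₀ n i‖ ≤ L)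
    (hC : Tendsto (cubicSum x β₀) atTop (𝓝 0)) {ε : ENNReal} (hε : 0 < ε) :
    ∃ K : ℝ, ∀ n, P {ω | K < ‖stdScore x β₀ n (fun i => Y i ω)‖} ≤ ε := by
  have (n : ℕ) : IsProbabilityMeasure (P.map fun ω => stdScore x β₀ n (fun i => Y i ω)) :=
    Measure.isProbabilityMeasure_map (hY.aemeasurable_stdScore n)
  have ht := isTightMeasureSet_of_tendsto_charFun
    (μ := fun n => P.map fun ω => stdScore x β₀ n (fun i => Y i ω))
    (f := fun t => Complex.exp (-‖t‖ ^ 2 / 2)) (by fun_prop)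
    (hY.tendsto_charFun_stdScore hJ hL hC)
  obtain ⟨K, hK⟩ := ((ENNReal.tendsto_nhds_zero.1
    (tendsto_measure_norm_gt_of_isTightMeasureSet ht)) ε hε).exists
  refine ⟨K, fun n => ?_⟩
  have h := (le_iSup₂ (f := fun (μ : Measure (EuclideanSpace ℝ (Fin p)))
    (_ : μ ∈ Set.range fun n => P.map fun ω => stdScore x β₀ n (fun i => Y i ω)) =>
      μ {x | K < ‖x‖}) _ (Set.mem_range_self n)).trans hK
  rwa [Measure.map_apply_of_aemeasurable (hY.aemeasurable_stdScore n)
    (measurableSet_lt measurable_const measurable_norm)] at h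

/-- The standardised maximum likelihood estimator is asymptotically equivalent to the standardised
score. -/
lemma IsModel.tendstoInMeasure_mle_sub_stdScore (hY : IsModel P x β₀ Y)
    {βhat : ℕ → Ω → EuclideanSpace ℝ (Fin p)} (hβhat : IsMLESequence P x Y βhat)
    (hJ : ∀ᶠ n in atTop, (infoMatrix x β₀ n).PosDef) {L : ℝ} (hL0 : 0 ≤ L)
    (hL : ∀ n, ∀ i < n, ‖stdCovariate x β₀ n i‖ ≤ L)
    (hC : Tendsto (cubicSum x β₀) atTop (𝓝 0)) :
    TendstoInMeasure P
      ((fun n ω => Matrix.toEuclideanCLM (𝕜 := ℝ) (infoSqrt x β₀ n) (βhat n ω - β₀)) -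
        fun n ω => stdScore x β₀ n (fun i => Y i ω)) atTop 0 := by
  rw [tendstoInMeasure_iff_norm]
  intro ε hε
  rw [ENNReal.tendsto_nhds_zero]
  intro η hη
  obtain ⟨K, hK⟩ := hY.exists_forall_measure_norm_stdScore_gt_le hJ hL hC hη
  have hr0 : 0 < min ε 1 := lt_min hε one_pos
  have hsmall := hC.const_mul (2 * (K + 1) ^ 3 * Real.exp (2 * ((K + 1) * L)))
  rw [mul_zero] at hsmall
  filter_upwards [hJ, hsmall.eventually (gt_mem_nhds (by positivity : 0 < (min ε 1) ^ 2 / 4))]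
    with n hn hs
  -- For such n, a deviation of at least ε can occur, up to a null set, only where the score exceeds
  -- K in norm; elsewhere a maximiser exists, so the estimator is one and lies near the score.
  refine (measure_mono_ae ?_).trans (hK n)
  filter_upwards [hβhat.isMLE n] with ω hω hεω
  by_contra hle
  obtain ⟨hex, hnear⟩ := exists_isMLE_and_norm_sub_lt hn hL0 (hL n) (fun i => Y i ω)
    (not_lt.1 hle) hr0 (min_le_right _ _) hs
  have h1 := (hnear _ (hω hex)).trans_le (min_le_left _ _)
  have h2 : ε ≤ ‖Matrix.toEuclideanCLM (𝕜 := ℝ) (infoSqrt x β₀ n) (βhat n ω - β₀) -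
      stdScore x β₀ n (fun i => Y i ω)‖ := by
    simpa using! hεω
  exact h1.not_ge h2

end CentralLimit

end LogisticRegression

theorem theorem5p2 {p : ℕ} {Ω : Type*} [MeasurableSpace Ω] (P : Measure Ω)
    [IsProbabilityMeasure P]
    (x : ℕ → EuclideanSpace ℝ (Fin p)) (β₀ : EuclideanSpace ℝ (Fin p))
    (Y : ℕ → Ω → ℝ) (hY : LogisticRegression.IsModel P x β₀ Y)
    (βhat : ℕ → Ω → EuclideanSpace ℝ (Fin p))
    (hβhat : LogisticRegression.IsMLESequence P x Y βhat)
    (hJ : ∀ᶠ n in atTop, (LogisticRegression.infoMatrix x β₀ n).PosDef)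
    (hlam : BddAbove (Set.range (LogisticRegression.maxNorm x β₀)))
    (hN : ∀ δ : ℝ, 0 < δ →
      Tendsto (fun n => LogisticRegression.lindebergSum x β₀ n δ) atTop (𝓝 0)) :
    TendstoInDistribution
      (fun n ω => Matrix.toEuclideanCLM (𝕜 := ℝ) (LogisticRegression.infoSqrt x β₀ n)
        (βhat n ω - β₀))
      atTop (id : EuclideanSpace ℝ (Fin p) → EuclideanSpace ℝ (Fin p)) (fun _ => P)
      (multivariateGaussian 0 (1 : Matrix (Fin p) (Fin p) ℝ)) := by
  obtain ⟨L, hL⟩ := hlam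
  -- Nonnegativity lets ‖t‖ L be enlarged to (K + 1) L. When J_n is singular, the matrix inverse is
  -- 0 by convention and the bound is vacuous.
  have hL' (n : ℕ) (i : ℕ) (hi : i < n) :
      ‖LogisticRegression.stdCovariate x β₀ n i‖ ≤ max L 0 :=
    ((LogisticRegression.norm_stdCovariate_le_maxNorm hi).trans
      (hL (Set.mem_range_self n))).trans (le_max_left _ _)
  have hC := LogisticRegression.tendsto_cubicSum hJ hL' hN
  exact tendstoInDistribution_of_tendstoInMeasure_sub _ _
    (hY.tendstoInDistribution_stdScore hJ hL' hC)
    (hY.tendstoInMeasure_mle_sub_stdScore hβhat hJ (le_max_right _ _) hL' hC)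
    fun n => (Matrix.toEuclideanCLM (𝕜 := ℝ) (LogisticRegression.infoSqrt x β₀ n)).continuous
      |>.measurable.comp_aemeasurable ((hβhat.aemeasurable n).sub_const β₀)
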